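/- Let $\mathcal k$ be an $F$-finite field of characteristic $p>0$, let $R$ be a reduced $\mathcal k$-algebra essentially of finite type, let $\mathfrak a\subset R$ be an ideal containing a nonzerodivisor, let $t\in\mathbb R_{\ge 0}$, and let $n\ge 1$ and $m\ge 0$ be integers. Notation. For a ring $A$ of characteristic $p$ put $\mathcal C_{e,A}=\operatorname{Hom}_A(F^e_*A,A)$, where $F$ is the Frobenius. A Cartier subalgebra $\mathcal C=\bigoplus_{e\ge 0}\mathcal C_e$ of the full Cartier algebra $\mathcal C_R=\bigoplus_{e\ge 0}\mathcal C_{e,R}$ is a graded subring (with product $\varphi\cdot\psi=\varphi\circ F^e_*\psi$ for $\varphi\in\mathcal C_{e}$) with $\mathcal C_0=\mathcal C_{0,R}=R$. An ideal $I\subset R$ is $\mathcal C$-compatible if $\varphi(F^e_*I)\subset I$ for all $e$ and all $\varphi\in\mathcal C_e$. The test ideal $\tau(R,\mathcal C)$ is the smallest $\mathcal C$-compatible ideal that is not contained in any minimal prime $\eta$ of $R$ for which there are $e\ge 1$ and $\varphi\in\mathcal C_e$ with $\varphi(F^e_*R)\not\subset\eta$; so if every minimal prime has this property ($\mathcal C$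 is nondegenerate), $\tau(R,\mathcal C)$ is the smallest $\mathcal C$-compatible ideal containing a nonzerodivisor. For an ideal $\mathfrak b$ and $s\in\mathbb R_{\ge 0}$, let $\tau(R,\mathcal C;\mathfrak b^s)=\tau(R,\mathcal C^{\mathfrak b^s})$, where $\mathcal C^{\mathfrak b^s}_e=\mathcal C_e\cdot\mathfrak b^{\lceil s(p^e-1)\rceil}$ consists of the finite sums of maps $\varphi(F^e_*x\cdot -)$ with $\varphi\in\mathcal C_e$, $x\in\mathfrak b^{\lceil s(p^e-1)\rceil}$. The $n$-th diagonal Cartier algebra $\mathcal D^{(n)}$ consists in degree $e$ of those $\varphi\in\mathcal C_{e,R}$ for which there is $\widehat\varphi\in\mathcal C_{e,R^{\otimes n}}$ with $\Delta_n\circ\widehat\varphi=\varphi\circ F^e_*\Delta_n$, where $R^{\otimes n}$ is the $n$-fold tensor power over $\mathcal k$ and $\Delta_n:R^{\otimes n}\to R$, $r_1\otimes\cdots\otimes r_n\mapsto r_1\cdots r_n$. The ring $R$ is diagonally $F$-regular if $\tau(R,\mathcal D^{(j)})=R$ for all $j\ge 1$. Then: (a) (Unambiguity) $\tau(R,\mathcal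 D^{(n)};\mathfrak a^{mt})=\tau(R,\mathcal D^{(n)};(\mathfrak a^m)^t)$. (b) (Fundamental lower bound) $\mathfrak a\cdot\tau(R,\mathcal D^{(n)})\subset\tau(R,\mathcal D^{(n)};\mathfrak a)$; in particular, if $R$ is diagonally $F$-regular, then $\mathfrak a\subset\tau(R,\mathcal D^{(n)};\mathfrak a)$. (c) (Subadditivity) $\tau(R,\mathcal D^{(n)};\mathfrak a^{tn})\subset\tau(R,\mathcal C_R;\mathfrak a^t)^n$. -/

import Mathlib

/-- `Hom_R(F^e_* R, R)`: the additive maps `φ : R → R` with `φ (r ^ (p ^ e) * x) = r * φ x`.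
In characteristic `p` these are exactly the `R`-linear maps `F^e_* R → R`; for `e = 0` they are
the multiplications by elements of `R`. -/
def cartierMaps (p e : ℕ) (R : Type*) [CommRing R] : AddSubgroup (AddMonoid.End R) where
  carrier := {φ | ∀ r x : R, φ (r ^ (p ^ e) * x) = r * φ x}
  zero_mem' := fun r _ => (mul_zero r).symm
  add_mem' := by
    intro φ ψ hφ hψ r x
    change φ _ + ψ _ = r * (φ x + ψ x)
    rw [hφ r x, hψ r x, mul_add]
  neg_mem' := by
    intro φ hφ r x
    change -φ _ = r * -φ x
    rw [hφ r x, mul_neg]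

/-- A Cartier subalgebra `C = ⨁ C_e` of the full Cartier algebra of `R`.  The product of `φ ∈ C_e`
and `ψ ∈ C_d` is the composition `φ ∘ F^e_* ψ`, an element of degree `e + d`.  Since `C_0 = R`
(acting by multiplication), closure under products contains the `R`-bimodule structure
`r · φ = r * φ(-)`, `φ · r = φ(r * -)`. -/
structure CartierSubalgebra (p : ℕ) (R : Type*) [CommRing R] where
  deg : ℕ → AddSubgroup (AddMonoid.End R)
  deg_le : ∀ e, deg e ≤ cartierMaps p e R
  deg_zero : deg 0 = cartierMaps p 0 R
  mul_mem : ∀ e d φ ψ, φ ∈ deg e → ψ ∈ deg d → φ * ψ ∈ deg (e + d)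

theorem cartierMaps_mul_mem (p : ℕ) (R : Type*) [CommRing R] (e d : ℕ) (φ ψ : AddMonoid.End R)
    (hφ : φ ∈ cartierMaps p e R) (hψ : ψ ∈ cartierMaps p d R) :
    φ * ψ ∈ cartierMaps p (e + d) R := by
  intro r x
  have h : r ^ (p ^ (e + d)) = (r ^ (p ^ e)) ^ (p ^ d) := by rw [← pow_mul, ← pow_add]
  change φ (ψ _) = r * φ (ψ x)
  rw [h, hψ, hφ]

/-- The full Cartier algebra `C_R`, with `C_{e,R} = Hom_R(F^e_* R, R)`. -/
def fullCartierAlgebra (p : ℕ) (R : Type*) [CommRing R] : CartierSubalgebra p R where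
  deg e := cartierMaps p e R
  deg_le _ := le_rfl
  deg_zero := rfl
  mul_mem := cartierMaps_mul_mem p R

namespace CartierSubalgebra

variable {p : ℕ} {R : Type*} [CommRing R]

/-- The Cartier subalgebra `C^{𝔞^t}`, whose degree `e` part is `C_e · 𝔞^⌈t(p^e - 1)⌉`: the finite
sums of maps `φ(x * -)` with `φ ∈ C_e` and `x ∈ 𝔞^⌈t(p^e - 1)⌉`. -/
def twist (C : CartierSubalgebra p R) (a : Ideal R) (t : ℝ) : CartierSubalgebra p R where
  deg e := AddSubgroup.closure
    {θ | ∃ φ ∈ C.deg e, ∃ x ∈ a ^ ⌈t * ((p : ℝ) ^ e - 1)⌉₊, θ = φ * AddMonoid.End.mulLeft x}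
  deg_le e := by
    rw [AddSubgroup.closure_le]
    rintro _ ⟨φ, hφ, x, -, rfl⟩ r y
    have := C.deg_le e hφ r (x * y)
    change φ (x * (r ^ (p ^ e) * y)) = r * φ (x * y)
    rw [← this]
    congr 1
    ring
  deg_zero := by
    apply le_antisymm
    · rw [AddSubgroup.closure_le]
      rintro _ ⟨φ, hφ, x, -, rfl⟩ r y
      have := C.deg_le 0 hφ r (x * y)
      change φ (x * (r ^ (p ^ 0) * y)) = r * φ (x * y)
      rw [← this]
      congr 1
      ring
    · intro φ hφ
      refine AddSubgroup.subset_closure ⟨φ, by rwa [C.deg_zero], 1, by simp, ?_⟩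
      ext y
      change φ y = φ (1 * y)
      rw [one_mul]
  mul_mem := by
    intro e d φ ψ hφ hψ
    have hceil : ⌈t * ((p : ℝ) ^ (e + d) - 1)⌉₊ ≤
        ⌈t * ((p : ℝ) ^ e - 1)⌉₊ * p ^ d + ⌈t * ((p : ℝ) ^ d - 1)⌉₊ := by
      rw [Nat.ceil_le]
      push_cast
      have h1 := Nat.le_ceil (t * ((p : ℝ) ^ e - 1))
      have h2 := Nat.le_ceil (t * ((p : ℝ) ^ d - 1))
      have h3 : (0 : ℝ) ≤ (p : ℝ) ^ d := by positivity
      have h4 := mul_le_mul_of_nonneg_right h1 h3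
      calc t * ((p : ℝ) ^ (e + d) - 1)
          = t * ((p : ℝ) ^ e - 1) * (p : ℝ) ^ d + t * ((p : ℝ) ^ d - 1) := by ring
        _ ≤ _ := add_le_add h4 h2
    induction hφ using AddSubgroup.closure_induction with
    | zero => rw [zero_mul]; exact AddSubgroup.zero_mem _
    | add _ _ _ _ h1 h2 => rw [add_mul]; exact AddSubgroup.add_mem _ h1 h2
    | neg _ _ h => exact AddSubgroup.neg_mem _ h
    | mem _ hφ =>
      obtain ⟨φ, hφ, x, hx, rfl⟩ := hφ
      induction hψ using AddSubgroup.closure_induction with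
      | zero => rw [mul_zero]; exact AddSubgroup.zero_mem _
      | add _ _ _ _ h1 h2 => rw [mul_add]; exact AddSubgroup.add_mem _ h1 h2
      | neg θ _ h =>
        have h' : φ * AddMonoid.End.mulLeft x * -θ = -(φ * AddMonoid.End.mulLeft x * θ) := by
          ext z
          exact map_neg (φ * AddMonoid.End.mulLeft x) (θ z)
        rw [h']
        exact AddSubgroup.neg_mem _ h
      | mem _ hψ =>
        obtain ⟨ψ, hψ, y, hy, rfl⟩ := hψ
        refine AddSubgroup.subset_closure
          ⟨φ * ψ, C.mul_mem e d φ ψ hφ hψ, x ^ (p ^ d) * y, ?_, ?_⟩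
        · apply Ideal.pow_le_pow_right hceil
          rw [pow_add, pow_mul]
          exact Ideal.mul_mem_mul (Ideal.pow_mem_pow hx _) hy
        · ext z
          have := C.deg_le d hψ x (y * z)
          change φ (x * ψ (y * z)) = φ (ψ (x ^ (p ^ d) * y * z))
          rw [← this, mul_assoc]

/-- The ideal `I` is compatible with `C`: `φ(F^e_* I) ⊆ I` for all `e` and all `φ ∈ C_e`, i.e.
`I` is a Cartier `C`-submodule of `R`. -/
def IsCompatible (C : CartierSubalgebra p R) (I : Ideal R) : Prop :=
  ∀ e, ∀ φ ∈ C.deg e, ∀ x ∈ I, φ x ∈ I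

/-- Some map of `C` of positive degree is nonzero at `η`: `φ(F^e_* R) ⊄ η` for some `e ≥ 1` and
`φ ∈ C_e`.  For `R` reduced and `η` a minimal prime, this says `φ(F^e_* R) R_η ≠ 0`, or
equivalently that the Cartier module `R_η` (a field) is not nilpotent. -/
def NondegenerateAt (C : CartierSubalgebra p R) (η : Ideal R) : Prop :=
  ∃ e, 1 ≤ e ∧ ∃ φ ∈ C.deg e, ∃ x : R, φ x ∉ η

/-- The test ideal `τ(R, C)` of a Cartier subalgebra `C` of `C_R`, for `R` reduced: the smallest
`C`-compatible ideal `I` such that at every minimal prime `η` of `R` the inclusion `I_η ⊆ R_η` is an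
isomorphism up to nilpotent Cartier modules.  As `R_η` is a field, this means that `I ⊄ η` for every
minimal prime `η` at which `C` is nondegenerate.  In particular, if `C` is nondegenerate at every
minimal prime, then `τ(R, C)` is the smallest `C`-compatible ideal that contains a
nonzerodivisor. -/
def testIdeal (C : CartierSubalgebra p R) : Ideal R :=
  sInf {I | C.IsCompatible I ∧ ∀ η ∈ minimalPrimes R, C.NondegenerateAt η → ¬ I ≤ η}

/-- The test ideal `τ(R, C; 𝔞^t) = τ(R, C^{𝔞^t})`. -/
def testIdealPow (C : CartierSubalgebra p R) (a : Ideal R) (t : ℝ) : Ideal R :=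
  (C.twist a t).testIdeal

/-- `C` is (strongly) `F`-regular: `τ(R, C) = R`. -/
def IsFRegular (C : CartierSubalgebra p R) : Prop :=
  C.testIdeal = ⊤

end CartierSubalgebra

open scoped TensorProduct in
/-- The diagonal map `Δ_n : R ⊗_k ⋯ ⊗_k R → R`, `r₁ ⊗ ⋯ ⊗ r_n ↦ r₁ ⋯ r_n`. -/
noncomputable def diagonalMap (k R : Type*) [Field k] [CommRing R] [Algebra k R] (n : ℕ) :
    (⨂[k] _ : Fin n, R) →ₐ[k] R :=
  PiTensorProduct.liftAlgHom (MultilinearMap.mkPiAlgebra k (Fin n) R)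
    (by rw [MultilinearMap.mkPiAlgebra_apply]; simp)
    (fun x y => by
      rw [MultilinearMap.mkPiAlgebra_apply, MultilinearMap.mkPiAlgebra_apply,
        MultilinearMap.mkPiAlgebra_apply]
      exact Finset.prod_mul_distrib)

theorem diagonalMap_tprod (k R : Type*) [Field k] [CommRing R] [Algebra k R] (n : ℕ)
    (x : Fin n → R) : diagonalMap k R n (PiTensorProduct.tprod k x) = ∏ i, x i := by
  rw [diagonalMap, PiTensorProduct.liftAlgHom_apply, PiTensorProduct.lift.tprod,
    MultilinearMap.mkPiAlgebra_apply]

open scoped TensorProduct in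
/-- The `n`-th diagonal Cartier algebra `D^(n)` of `R` over `k` (`n ≥ 1`): in degree `e` it consists
of those `φ : F^e_* R → R` that lift to a map `ψ : F^e_* (R^{⊗ n}) → R^{⊗ n}`, that is,
`Δ_n ∘ ψ = φ ∘ F^e_* Δ_n`; such `ψ` is compatible with `ker Δ_n` and `φ` is the map it induces. -/
noncomputable def diagonalCartierAlgebra (p : ℕ) (k R : Type*) [Field k] [CommRing R] [Algebra k R]
    (n : ℕ) [NeZero n] : CartierSubalgebra p R where
  deg e :=
    { carrier := {φ | φ ∈ cartierMaps p e R ∧ ∃ ψ ∈ cartierMaps p e (⨂[k] _ : Fin n, R),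
        ∀ z, diagonalMap k R n (ψ z) = φ (diagonalMap k R n z)}
      zero_mem' := ⟨zero_mem _, 0, zero_mem _, fun z => map_zero (diagonalMap k R n)⟩
      add_mem' := by
        rintro φ φ' ⟨hφ, ψ, hψ, h⟩ ⟨hφ', ψ', hψ', h'⟩
        exact ⟨add_mem hφ hφ', ψ + ψ', add_mem hψ hψ', fun z => by
          change diagonalMap k R n (ψ z + ψ' z) = φ _ + φ' _
          rw [map_add, h, h']⟩
      neg_mem' := by
        rintro φ ⟨hφ, ψ, hψ, h⟩
        exact ⟨neg_mem hφ, -ψ, neg_mem hψ, fun z => by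
          change diagonalMap k R n (-ψ z) = -φ _
          rw [map_neg, h]⟩ }
  deg_le e := fun φ hφ => hφ.1
  deg_zero := by
    apply le_antisymm
    · exact fun φ hφ => hφ.1
    · intro φ hφ
      have hφ1 : ∀ x, φ x = φ 1 * x := by
        intro x
        have := hφ x 1
        rw [pow_zero, pow_one, mul_one] at this
        rw [this, mul_comm]
      let w : ⨂[k] _ : Fin n, R :=
        PiTensorProduct.tprod k (fun i : Fin n => if i = 0 then φ 1 else 1)
      have hw : diagonalMap k R n w = φ 1 := by
        refine (diagonalMap_tprod k R n _).trans ?_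
        simp
      refine ⟨hφ, AddMonoid.End.mulLeft w, ?_, ?_⟩
      · intro r x
        change w * (r ^ (p ^ 0) * x) = r * (w * x)
        rw [pow_zero, pow_one, mul_left_comm]
      · intro z
        change diagonalMap k R n (w * z) = φ _
        rw [map_mul, hw, ← hφ1]
  mul_mem := by
    rintro e d φ φ' ⟨hφ, ψ, hψ, h⟩ ⟨hφ', ψ', hψ', h'⟩
    refine ⟨cartierMaps_mul_mem p R e d _ _ hφ hφ', ψ * ψ',
      cartierMaps_mul_mem p _ e d _ _ hψ hψ', ?_⟩
    intro z
    change diagonalMap k R n (ψ (ψ' z)) = φ (φ' (diagonalMap k R n z))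
    rw [h, h']

/-- `R` is diagonally `F`-regular over `k`: `D^(n)` is `F`-regular for all `n ≥ 1`. -/
def IsDiagonallyFRegular (p : ℕ) (k R : Type*) [Field k] [CommRing R] [Algebra k R] : Prop :=
  ∀ (n : ℕ) [NeZero n], (diagonalCartierAlgebra p k R n).IsFRegular

/-!
For (a) and (b), let `C` be any Cartier subalgebra. As `𝔞` lies in no minimal prime, twisting by
powers of `𝔞` does not change where `C` is nondegenerate
(`CartierSubalgebra.nondegenerateAt_twist_iff`), so only compatible ideals have to be compared. For
unambiguity, `C^{(𝔞^m)^t} ⊆ C^{𝔞^{mt}}` gives one inclusion. Conversely, if `I` is compatible with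
`C^{(𝔞^m)^t}`, then the largest `C^{𝔞^{mt}}`-compatible ideal inside `I` contains `𝔞^m I`, because
rounding costs at most `m` factors of `𝔞`. For the lower bound, if `I` is compatible with `C^𝔞`, then
`I : 𝔞` is compatible with `C`.

For (c), put `T = τ(R, C_R; 𝔞^t)`. By (a) the left side is `τ(R, D^(n); (𝔞^n)^t)`, so it is
enough that `T^n` competes in the definition of this test ideal.

* `T^n` is compatible with the twisted algebra (`CartierSubalgebra.isCompatible_testIdealPow_pow`):
  let `φ ∈ D^(n)_e` lift to `ψ` and let `z_i ∈ 𝔞^⌈t(p^e-1)⌉ T`. Contracting all factors but the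
  `i`-th turns `ψ` into a `p^{-e}`-linear map of `R`, which sends `z_i` into `T`. Over a field,
  this forces `ψ(z_1 ⊗ ⋯ ⊗ z_n)` into the image of `T^{⊗ n}`, so that `φ(z_1 ⋯ z_n) ∈ T^n`.
* `T` is not contained in any minimal prime `η` where `C_R` is nondegenerate. This needs a test element
  `c ∉ η` (`exists_notMem_forall_mem`). Frobenius is finite on the domain `B = R / η`, so the
  coordinates over `B^p` are, up to denominators, `p^{-1}`-linear maps of `R`. A compatible ideal
  `I ⊄ η` therefore satisfies `d I' ⊆ I'^2` for its image `I'` in `B` and some `d ≠ 0` that does not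
  depend on `I`. The determinant trick gives `d^m ∈ I'`, hence a power of a fixed element lies in
  `I`, and applying one `p^{-1}`-linear map repeatedly brings the exponent down to a uniform bound.
-/

/-! ### Generalities on Cartier subalgebras -/

namespace CartierSubalgebra

variable {p : ℕ} {R : Type*} [CommRing R]

theorem mulLeft_mem_deg_zero (C : CartierSubalgebra p R) (r : R) :
    AddMonoid.End.mulLeft r ∈ C.deg 0 := by
  rw [C.deg_zero]
  intro s x
  change r * (s ^ p ^ 0 * x) = s * (r * x)
  rw [pow_zero, pow_one, mul_left_comm]

theorem mul_mulLeft_mem (C : CartierSubalgebra p R) {e : ℕ} {φ : AddMonoid.End R}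
    (hφ : φ ∈ C.deg e) (r : R) : φ * AddMonoid.End.mulLeft r ∈ C.deg e :=
  C.mul_mem e 0 φ _ hφ (C.mulLeft_mem_deg_zero r)

theorem mul_mulLeft_mem_twist (C : CartierSubalgebra p R) {a : Ideal R} {t : ℝ} {e : ℕ}
    {φ : AddMonoid.End R} (hφ : φ ∈ C.deg e) {x : R} (hx : x ∈ a ^ ⌈t * ((p : ℝ) ^ e - 1)⌉₊) :
    φ * AddMonoid.End.mulLeft x ∈ (C.twist a t).deg e :=
  AddSubgroup.subset_closure ⟨φ, hφ, x, hx, rfl⟩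

/-- An additive condition on the values of the maps in `C^{𝔞^t}` need only be checked on the
generators `φ(x * -)`. -/
theorem apply_mem_of_mem_twist {C : CartierSubalgebra p R} {a : Ideal R} {t : ℝ} {e : ℕ}
    {θ : AddMonoid.End R} (hθ : θ ∈ (C.twist a t).deg e) {I : Ideal R} {y : R}
    (h : ∀ φ ∈ C.deg e, ∀ x ∈ a ^ ⌈t * ((p : ℝ) ^ e - 1)⌉₊, φ (x * y) ∈ I) : θ y ∈ I := by
  change θ ∈ AddSubgroup.closure _ at hθ
  induction hθ using AddSubgroup.closure_induction with
  | zero => exact I.zero_mem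
  | add _ _ _ _ h1 h2 => exact I.add_mem h1 h2
  | neg _ _ h => exact I.neg_mem h
  | mem _ hφ =>
    obtain ⟨φ, hφ, x, hx, rfl⟩ := hφ
    exact h φ hφ x hx

theorem isCompatible_testIdeal (C : CartierSubalgebra p R) : C.IsCompatible C.testIdeal := by
  intro e φ hφ x hx
  rw [testIdeal, Submodule.mem_sInf] at hx ⊢
  exact fun I hI => hI.1 e φ hφ x (hx I hI)

theorem NondegenerateAt.mono {C C' : CartierSubalgebra p R} (h : ∀ e, C.deg e ≤ C'.deg e)
    {η : Ideal R} (hC : C.NondegenerateAt η) : C'.NondegenerateAt η := by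
  obtain ⟨e, he, φ, hφ, hx⟩ := hC
  exact ⟨e, he, φ, h e hφ, hx⟩

theorem testIdeal_mono {C C' : CartierSubalgebra p R} (h : ∀ e, C.deg e ≤ C'.deg e) :
    C.testIdeal ≤ C'.testIdeal :=
  sInf_le_sInf fun _ hI =>
    ⟨fun e φ hφ => hI.1 e φ (h e hφ), fun η hη hC => hI.2 η hη (hC.mono h)⟩

/-- Twisting by an ideal that is not contained in the prime `η` does not affect nondegeneracy
at `η`. -/
theorem nondegenerateAt_twist_iff (hp : p.Prime) (C : CartierSubalgebra p R) {a : Ideal R}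
    (t : ℝ) {η : Ideal R} [η.IsPrime] (ha : ¬ a ≤ η) :
    (C.twist a t).NondegenerateAt η ↔ C.NondegenerateAt η := by
  constructor
  · rintro ⟨e, he, θ, hθ, y, hy⟩
    by_contra hC
    refine hy (apply_mem_of_mem_twist hθ fun φ hφ x _ => ?_)
    by_contra hx
    exact hC ⟨e, he, φ, hφ, _, hx⟩
  · rintro ⟨e, he, φ, hφ, y, hy⟩
    obtain ⟨s, hs, hsη⟩ := SetLike.not_le_iff_exists.mp ha
    set N := ⌈t * ((p : ℝ) ^ e - 1)⌉₊
    have hx : (s ^ N) ^ p ^ e ∈ a ^ N :=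
      Ideal.pow_mem_of_mem _ (Ideal.pow_mem_pow hs N) _ (pow_pos hp.pos e)
    refine ⟨e, he, _, C.mul_mulLeft_mem_twist hφ hx, y, ?_⟩
    change φ ((s ^ N) ^ p ^ e * y) ∉ η
    rw [C.deg_le e hφ]
    exact fun h => (Ideal.IsPrime.mem_or_mem ‹_› h).elim
      (fun h => hsη (Ideal.IsPrime.mem_of_pow_mem ‹_› _ h)) hy

/-- The largest `C`-compatible ideal contained in `I`. -/
def compatibleCore (C : CartierSubalgebra p R) (I : Ideal R) : Ideal R where
  carrier := {y | ∀ e, ∀ θ ∈ C.deg e, θ y ∈ I}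
  zero_mem' := fun e θ _ => by rw [map_zero]; exact I.zero_mem
  add_mem' := fun hx hy e θ hθ => by rw [map_add]; exact I.add_mem (hx e θ hθ) (hy e θ hθ)
  smul_mem' := fun r _ hy e _ hθ => hy e _ (C.mul_mulLeft_mem hθ r)

theorem compatibleCore_le (C : CartierSubalgebra p R) (I : Ideal R) : C.compatibleCore I ≤ I := by
  intro y hy
  have := hy 0 _ (C.mulLeft_mem_deg_zero 1)
  change 1 * y ∈ I at this
  rwa [one_mul] at this

theorem isCompatible_compatibleCore (C : CartierSubalgebra p R) (I : Ideal R) :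
    C.IsCompatible (C.compatibleCore I) :=
  fun d θ' hθ' _ hy e θ hθ => hy (e + d) (θ * θ') (C.mul_mem e d θ θ' hθ hθ')

/-! ### Unambiguity and the lower bound -/

theorem twist_pow_deg_le (C : CartierSubalgebra p R) (a : Ideal R) (t : ℝ) (m e : ℕ) :
    (C.twist (a ^ m) t).deg e ≤ (C.twist a (m * t)).deg e := by
  change AddSubgroup.closure _ ≤ _
  rw [AddSubgroup.closure_le]
  rintro _ ⟨φ, hφ, x, hx, rfl⟩
  refine C.mul_mulLeft_mem_twist hφ ?_
  rw [← pow_mul] at hx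
  refine Ideal.pow_le_pow_right ?_ hx
  rw [Nat.ceil_le, mul_assoc]
  push_cast
  gcongr
  exact Nat.le_ceil _

/-- The exponents `m⌈s⌉` and `⌈ms⌉` differ by at most `m`, so multiplying by `𝔞^m` carries
`C^{𝔞^{mt}}` into `C^{(𝔞^m)^t}`. -/
theorem pow_mul_le_compatibleCore (hp : p.Prime) (C : CartierSubalgebra p R) (a : Ideal R)
    {t : ℝ} (ht : 0 ≤ t) (m : ℕ) {I : Ideal R} (hI : (C.twist (a ^ m) t).IsCompatible I) :
    a ^ m * I ≤ (C.twist a (m * t)).compatibleCore I := by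
  rw [Ideal.mul_le]
  intro u hu i hi e θ hθ
  refine apply_mem_of_mem_twist hθ fun φ hφ x hx => ?_
  have hs : 0 ≤ t * ((p : ℝ) ^ e - 1) :=
    mul_nonneg ht (sub_nonneg.mpr (one_le_pow₀ (by exact_mod_cast hp.one_le)))
  have hceil : m * ⌈t * ((p : ℝ) ^ e - 1)⌉₊ ≤ ⌈m * t * ((p : ℝ) ^ e - 1)⌉₊ + m := by
    have h1 := Nat.le_ceil (m * t * ((p : ℝ) ^ e - 1))
    have h2 := mul_le_mul_of_nonneg_left (Nat.ceil_lt_add_one hs).le (Nat.cast_nonneg (α := ℝ) m)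
    have : ((m * ⌈t * ((p : ℝ) ^ e - 1)⌉₊ : ℕ) : ℝ) ≤
        ((⌈m * t * ((p : ℝ) ^ e - 1)⌉₊ + m : ℕ) : ℝ) := by
      push_cast
      linarith
    exact_mod_cast this
  have hxu : x * u ∈ (a ^ m) ^ ⌈t * ((p : ℝ) ^ e - 1)⌉₊ := by
    rw [← pow_mul]
    refine Ideal.pow_le_pow_right hceil ?_
    rw [pow_add]
    exact Ideal.mul_mem_mul hx hu
  have := hI e _ (C.mul_mulLeft_mem_twist hφ hxu) i hi
  change φ (x * u * i) ∈ I at this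
  rwa [mul_assoc] at this

theorem testIdealPow_mul_eq (hp : p.Prime) (C : CartierSubalgebra p R) {a : Ideal R}
    (ha : ∀ η ∈ minimalPrimes R, ¬ a ≤ η) {t : ℝ} (ht : 0 ≤ t) (m : ℕ) :
    C.testIdealPow a (m * t) = C.testIdealPow (a ^ m) t := by
  refine le_antisymm (le_sInf fun I hI => ?_) (testIdeal_mono (C.twist_pow_deg_le a t m))
  refine le_trans (b := (C.twist a (m * t)).compatibleCore I) ?_ (compatibleCore_le _ I)
  refine sInf_le ⟨isCompatible_compatibleCore _ I, fun η hη hC hle => ?_⟩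
  have : η.IsPrime := hη.1.1
  have ham : ¬ a ^ m ≤ η := fun h => ha η hη (Ideal.IsPrime.le_of_pow_le h)
  rw [nondegenerateAt_twist_iff hp C _ (ha η hη), ← nondegenerateAt_twist_iff hp C t ham] at hC
  exact ((Ideal.IsPrime.mul_le ‹_›).mp ((pow_mul_le_compatibleCore hp C a ht m hI.1).trans hle)).elim
    ham (hI.2 η hη hC)

/-- If `I` is compatible with `C^{𝔞}`, then the colon ideal `I : 𝔞` is compatible with `C`, since
`y φ(x) = φ(y^{p^e - 1} * (y x))`. -/
theorem isCompatible_colon (hp : p.Prime) (C : CartierSubalgebra p R) (a : Ideal R) {I : Ideal R}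
    (hI : (C.twist a 1).IsCompatible I) : C.IsCompatible (I.colon a) := by
  intro e φ hφ x hx
  rw [Submodule.mem_colon] at hx ⊢
  intro y hy
  have hceil : ⌈1 * ((p : ℝ) ^ e - 1)⌉₊ = p ^ e - 1 := by
    have : (1 : ℝ) * ((p : ℝ) ^ e - 1) = ((p ^ e - 1 : ℕ) : ℝ) := by
      rw [Nat.cast_sub (Nat.one_le_pow _ _ hp.pos)]
      push_cast
      ring
    rw [this, Nat.ceil_natCast]
  have hmem := hI e _ (C.mul_mulLeft_mem_twist hφ (x := y ^ (p ^ e - 1))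
    (by rw [hceil]; exact Ideal.pow_mem_pow hy _)) _ (hx y hy)
  change φ (y ^ (p ^ e - 1) * (x * y)) ∈ I at hmem
  have hpow : y ^ (p ^ e - 1) * (x * y) = y ^ p ^ e * x := by
    rw [mul_comm x, ← mul_assoc, pow_sub_one_mul (pow_pos hp.pos e).ne']
  rw [hpow, C.deg_le e hφ, mul_comm] at hmem
  exact hmem

theorem mul_testIdeal_le (hp : p.Prime) (C : CartierSubalgebra p R) {a : Ideal R}
    (ha : ∀ η ∈ minimalPrimes R, ¬ a ≤ η) : a * C.testIdeal ≤ C.testIdealPow a 1 := by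
  refine le_sInf fun I hI => ?_
  have hle : C.testIdeal ≤ I.colon a := by
    refine sInf_le ⟨isCompatible_colon hp C a hI.1, fun η hη hC hle => ?_⟩
    have : η.IsPrime := hη.1.1
    rw [← nondegenerateAt_twist_iff hp C 1 (ha η hη)] at hC
    refine hI.2 η hη hC (le_trans (fun x hx => ?_) hle)
    exact Submodule.mem_colon.mpr fun y _ => I.mul_mem_right y hx
  rw [Ideal.mul_le]
  intro y hy x hx
  rw [mul_comm]
  exact Submodule.mem_colon.mp (hle hx) y hy

end CartierSubalgebra

/-! ### Maps induced on diagonals of tensor powers -/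

section TensorPower

open scoped TensorProduct

variable {p : ℕ} {k R : Type*} [Field k] [CommRing R] [Algebra k R] {n : ℕ}

/-- The `k`-linear map `R^{⊗ n} → R`, `r₁ ⊗ ⋯ ⊗ r_n ↦ (∏_{j ≠ i} f_j(r_j)) r_i`, given by
functionals `f_j : R → k` (`f_i` is not used): contraction of all factors but the `i`-th. -/
noncomputable def contractExcept (f : Fin n → R →ₗ[k] k) (i : Fin n) :
    (⨂[k] _ : Fin n, R) →ₗ[k] R :=
  PiTensorProduct.lift ((MultilinearMap.mkPiAlgebra k (Fin n) R).compLinearMap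
    fun j => if j = i then LinearMap.id else Algebra.linearMap k R ∘ₗ f j)

theorem contractExcept_tprod (f : Fin n → R →ₗ[k] k) (i : Fin n) (x : Fin n → R) :
    contractExcept f i (PiTensorProduct.tprod k x) =
      ∏ j, (if j = i then LinearMap.id else Algebra.linearMap k R ∘ₗ f j) (x j) := by
  rw [contractExcept, PiTensorProduct.lift.tprod]
  rfl

/-- Contraction is linear over the `i`-th factor. -/
theorem contractExcept_mul (f : Fin n → R →ₗ[k] k) (i : Fin n) (r : R)
    (v : ⨂[k] _ : Fin n, R) :
    contractExcept f i (PiTensorProduct.tprod k (Pi.mulSingle i r) * v) =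
      r * contractExcept f i v := by
  induction v using PiTensorProduct.induction_on with
  | smul_tprod c x =>
    rw [mul_smul_comm, map_smul, map_smul, mul_smul_comm, PiTensorProduct.tprod_mul_tprod,
      contractExcept_tprod, contractExcept_tprod]
    congr 1
    rw [← Finset.mul_prod_erase _ _ (Finset.mem_univ i),
      ← Finset.mul_prod_erase Finset.univ (fun j => (if j = i then LinearMap.id else
        Algebra.linearMap k R ∘ₗ f j) (x j)) (Finset.mem_univ i)]
    simp only [if_true, LinearMap.id_apply, Pi.mul_apply, Pi.mulSingle_eq_same, mul_assoc]
    congr 2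
    refine Finset.prod_congr rfl fun j hj => ?_
    rw [Pi.mulSingle_eq_of_ne (Finset.ne_of_mem_erase hj), one_mul]
  | add v w hv hw => rw [mul_add, map_add, map_add, hv, hw, mul_add]

/-- Freezing all factors but the `i`-th in the source and contracting them in the target turns a
`p^{-e}`-linear map of `R^{⊗ n}` into one of `R`. -/
theorem exists_cartierMaps_contractExcept {e : ℕ} {ψ : AddMonoid.End (⨂[k] _ : Fin n, R)}
    (hψ : ψ ∈ cartierMaps p e (⨂[k] _ : Fin n, R)) (z : Fin n → R) (f : Fin n → R →ₗ[k] k)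
    (i : Fin n) :
    ∃ θ ∈ cartierMaps p e R,
      θ (z i) = contractExcept f i (ψ (PiTensorProduct.tprod k z)) := by
  let θ : AddMonoid.End R := AddMonoidHom.mk'
    (fun s => contractExcept f i (ψ (PiTensorProduct.tprod k (Function.update z i s))))
    (fun s s' => by rw [MultilinearMap.map_update_add, map_add, map_add])
  refine ⟨θ, fun r s => ?_, ?_⟩
  · change contractExcept f i (ψ _) = r * contractExcept f i (ψ _)
    have : PiTensorProduct.tprod k (Function.update z i (r ^ p ^ e * s)) =
        PiTensorProduct.tprod k (Pi.mulSingle i r) ^ p ^ e *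
          PiTensorProduct.tprod k (Function.update z i s) := by
      have hpow := map_pow (PiTensorProduct.tprodMonoidHom k) (Pi.mulSingle i r : Fin n → R) (p ^ e)
      simp only [PiTensorProduct.tprodMonoidHom_apply] at hpow
      rw [← hpow, PiTensorProduct.tprod_mul_tprod]
      congr 1
      ext j
      by_cases hj : j = i
      · subst hj; simp
      · simp [hj]
    rw [this, hψ, contractExcept_mul]
  · change contractExcept f i (ψ (PiTensorProduct.tprod k (Function.update z i (z i)))) = _
    rw [Function.update_eq_self]

/-- In a basis of `R` over `k`, the coordinates of `v ∈ R^{⊗ n}` are coordinates of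
contractions of `v`. -/
theorem piTensorProduct_repr_eq_repr_contractExcept {κ : Type*} (b : Module.Basis κ k R)
    (v : ⨂[k] _ : Fin n, R) (q : Fin n → κ) (i : Fin n) :
    (Basis.piTensorProduct (fun _ : Fin n => b)).repr v q =
      b.repr (contractExcept (fun j => b.coord (q j)) i v) (q i) := by
  induction v using PiTensorProduct.induction_on with
  | smul_tprod c x =>
    rw [map_smul, map_smul, map_smul, Finsupp.smul_apply, Finsupp.smul_apply,
      Basis.piTensorProduct_repr_tprod_apply, contractExcept_tprod]
    congr 1
    rw [← Finset.mul_prod_erase _ _ (Finset.mem_univ i),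
      ← Finset.mul_prod_erase _ _ (Finset.mem_univ i)]
    have : ∏ j ∈ Finset.univ.erase i, (if j = i then LinearMap.id else
        Algebra.linearMap k R ∘ₗ b.coord (q j)) (x j) =
        algebraMap k R (∏ j ∈ Finset.univ.erase i, b.repr (x j) (q j)) := by
      rw [map_prod]
      refine Finset.prod_congr rfl fun j hj => ?_
      rw [if_neg (Finset.ne_of_mem_erase hj)]
      rfl
    rw [this, if_pos rfl, LinearMap.id_apply, mul_comm (x i), ← Algebra.smul_def, map_smul,
      Finsupp.smul_apply, smul_eq_mul, mul_comm]
  | add v w hv hw => simp only [map_add, Finsupp.add_apply, hv, hw]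

/-- If all contractions of `v` onto single factors lie in the ideal `T`, then `v` lies in the
image of `T^{⊗ n}`, so that `Δ_n(v) ∈ T ^ n`. -/
theorem diagonalMap_mem_pow {T : Ideal R} {v : ⨂[k] _ : Fin n, R}
    (hv : ∀ (f : Fin n → R →ₗ[k] k) (i : Fin n), contractExcept f i v ∈ T) :
    diagonalMap k R n v ∈ T ^ n := by
  obtain ⟨T', hT'⟩ := (T.restrictScalars k).exists_isCompl
  -- a basis of `R` made up of a basis of `T` and a basis of a complement of `T`
  let b := ((Module.Basis.ofVectorSpace k (T.restrictScalars k)).prod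
    (Module.Basis.ofVectorSpace k T')).map (Submodule.prodEquivOfIsCompl _ _ hT')
  have hinr : ∀ x ∈ T, ∀ j, b.repr x (Sum.inr j) = 0 := by
    intro x hx j
    have : (Submodule.prodEquivOfIsCompl _ _ hT').symm x = ((⟨x, hx⟩ : T.restrictScalars k), 0) :=
      Submodule.prodEquivOfIsCompl_symm_apply_left _ _ hT' ⟨x, hx⟩
    simp [b, this]
  have hinl : ∀ j, b (Sum.inl j) ∈ T := by
    intro j
    have : b (Sum.inl j) = (Module.Basis.ofVectorSpace k (T.restrictScalars k) j : R) := by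
      simp [b]
    rw [this]
    exact (Module.Basis.ofVectorSpace k (T.restrictScalars k) j).2
  rw [← (Basis.piTensorProduct (fun _ : Fin n => b)).linearCombination_repr v,
    Finsupp.linearCombination_apply, Finsupp.sum, map_sum]
  refine Ideal.sum_mem _ fun q _ => ?_
  rw [map_smul, Basis.piTensorProduct_apply, diagonalMap_tprod]
  by_cases hq : ∀ i, ∃ j, q i = Sum.inl j
  · rw [Algebra.smul_def]
    refine Ideal.mul_mem_left _ _ ?_
    have := Ideal.prod_mem_prod (s := Finset.univ) (I := fun _ : Fin n => T)
      (x := fun i => b (q i)) fun i _ => by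
        obtain ⟨j, hj⟩ := hq i
        rw [hj]
        exact hinl j
    rwa [Finset.prod_const, Finset.card_univ, Fintype.card_fin] at this
  · push Not at hq
    obtain ⟨i, hi⟩ := hq
    obtain ⟨j, hj⟩ : ∃ j, q i = Sum.inr j := by
      cases h : q i with
      | inl j => exact absurd h (hi j)
      | inr j => exact ⟨j, rfl⟩
    rw [piTensorProduct_repr_eq_repr_contractExcept b v q i, hj, hinr _ (hv _ i), zero_smul]
    exact Ideal.zero_mem _

/-- The key to subadditivity: the values of `φ ∈ D^(n)` on products are controlled, factor by factor,
by the `p^{-e}`-linear maps of `R`. -/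
theorem diagonalCartierAlgebra_apply_prod_mem_pow [NeZero n] {e : ℕ} {φ : AddMonoid.End R}
    (hφ : φ ∈ (diagonalCartierAlgebra p k R n).deg e) {T : Ideal R} {z : Fin n → R}
    (hz : ∀ i, ∀ θ ∈ cartierMaps p e R, θ (z i) ∈ T) : φ (∏ i, z i) ∈ T ^ n := by
  obtain ⟨-, ψ, hψ, h⟩ := hφ
  rw [← diagonalMap_tprod k, ← h]
  refine diagonalMap_mem_pow fun f i => ?_
  obtain ⟨θ, hθ, hθz⟩ := exists_cartierMaps_contractExcept hψ z f i
  rw [← hθz]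
  exact hz i θ hθ

end TensorPower

/-! ### Finiteness of Frobenius -/

/-- If all `q`-th powers of elements of `B` come from `A`, then `B` is integral over `A`, and a
unit `u` of `B` has the inverse `u ^ (q - 1) * (u⁻¹) ^ q` in every subalgebra that contains `u`; so
no localization is needed to generate `B`. -/
theorem Algebra.EssFiniteType.finite_of_forall_pow_mem_range {A B : Type*} [CommRing A]
    [CommRing B] [Algebra A B] [Algebra.EssFiniteType A B] {q : ℕ} (hq : q ≠ 0)
    (h : ∀ x : B, ∃ y : A, algebraMap A B y = x ^ q) : Module.Finite A B := by
  obtain ⟨σ, hσ⟩ := (Algebra.essFiniteType_iff A B).mp ‹_›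
  have htop : Algebra.adjoin A (σ : Set B) = ⊤ := by
    refine Algebra.eq_top_iff.mpr fun s => ?_
    obtain ⟨_, ht, ⟨u, rfl⟩, hst⟩ := hσ s
    obtain ⟨y, hy⟩ := h ↑u⁻¹
    have hinv : (u : B) ^ (q - 1) * algebraMap A B y = ↑u⁻¹ := by
      rw [hy, ← pow_sub_one_mul hq (↑u⁻¹ : B), ← mul_assoc, ← mul_pow, Units.mul_inv, one_pow,
        one_mul]
    have := mul_mem hst (hinv ▸ mul_mem (pow_mem ht _) (Subalgebra.algebraMap_mem _ y))
    rwa [Units.mul_inv_cancel_right] at this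
  have : Algebra.FiniteType A B := ⟨⟨σ, htop⟩⟩
  have : Algebra.IsIntegral A B := ⟨fun x => by
    obtain ⟨y, hy⟩ := h x
    exact ⟨Polynomial.X ^ q - Polynomial.C y, Polynomial.monic_X_pow_sub_C y hq, by simp [hy]⟩⟩
  exact Algebra.IsIntegral.finite

theorem frobenius_finite_of_essFiniteType (p : ℕ) [Fact p.Prime] {k B : Type*} [Field k]
    [CharP k p] (hk : (frobenius k p).Finite) [CommRing B] [CharP B p] [Algebra k B]
    [Algebra.EssFiniteType k B] : (frobenius B p).Finite := by
  have hkB : (algebraMap k B).EssFiniteType := by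
    rw [RingHom.EssFiniteType, toAlgebra_algebraMap]
    infer_instance
  have hcomp : ((frobenius B p).comp (algebraMap k B)).EssFiniteType := by
    have : (frobenius B p).comp (algebraMap k B) = (algebraMap k B).comp (frobenius k p) := by
      ext x
      simp [frobenius_def]
    rw [this]
    exact hk.finiteType.essFiniteType.comp hkB
  have hess : (frobenius B p).EssFiniteType := hcomp.of_comp
  let := (frobenius B p).toAlgebra
  have : Algebra.EssFiniteType B B := hess
  exact Algebra.EssFiniteType.finite_of_forall_pow_mem_range (Fact.out : p.Prime).ne_zero
    fun x => ⟨x, rfl⟩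

/-! ### Generic freeness and the determinant trick over a domain -/

/-- A finite module over a domain becomes free after inverting a nonzero element `c`; here the dual
basis is multiplied by `c`, so that it consists of maps defined on the whole module. -/
theorem Module.Finite.exists_smul_eq_sum_smul (A M : Type*) [CommRing A] [IsDomain A]
    [AddCommGroup M] [Module A M] [Module.Finite A M] :
    ∃ (c : A) (r : ℕ) (g : Fin r → M) (μ : Fin r → M →ₗ[A] A), c ≠ 0 ∧
      ∀ y, c • y = ∑ i, μ i y • g i := by
  obtain ⟨n, v, hv⟩ := Module.Finite.exists_fin (R := A) (M := M)
  obtain ⟨s, hs, hmax⟩ := exists_maximal_linearIndepOn A v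
  have hmax' : ∀ i, ∃ a : A, a ≠ 0 ∧ a • v i ∈ Submodule.span A (v '' s) := by
    intro i
    by_cases hi : i ∈ s
    · exact ⟨1, one_ne_zero, by
        rw [one_smul]; exact Submodule.subset_span (Set.mem_image_of_mem v hi)⟩
    · exact hmax i hi
  choose d hd0 hd using hmax'
  have hc : ∀ y, (∏ i, d i) • y ∈ Submodule.span A (Set.range fun i : s => v i) := by
    rw [← Set.image_eq_range]
    intro y
    have hy : y ∈ Submodule.span A (Set.range v) := hv ▸ Submodule.mem_top
    induction hy using Submodule.span_induction with
    | zero => rw [smul_zero]; exact Submodule.zero_mem _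
    | add _ _ _ _ h1 h2 => rw [smul_add]; exact Submodule.add_mem _ h1 h2
    | smul r _ _ h => rw [smul_comm]; exact Submodule.smul_mem _ r h
    | mem _ h =>
      obtain ⟨i, rfl⟩ := h
      rw [← Finset.prod_erase_mul _ _ (Finset.mem_univ i), mul_smul]
      exact Submodule.smul_mem _ _ (hd i)
  classical
  let b := Module.Basis.span (v := fun i : s => v i) hs
  let w := Fintype.equivFin s
  let L : M →ₗ[A] Submodule.span A (Set.range fun i : s => v i) :=
    (LinearMap.lsmul A M (∏ i, d i)).codRestrict _ hc
  refine ⟨∏ i, d i, Fintype.card s, fun i => v (w.symm i), fun i => b.coord (w.symm i) ∘ₗ L,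
    Finset.prod_ne_zero_iff.mpr fun i _ => hd0 i, fun y => ?_⟩
  have h := congrArg Subtype.val (b.sum_repr (L y))
  rw [Equiv.sum_comp w.symm (fun i => (b.coord i ∘ₗ L) y • v i)]
  rw [AddSubmonoidClass.coe_finsetSum] at h
  refine h.symm.trans (Finset.sum_congr rfl fun i _ => ?_)
  rw [Submodule.coe_smul, Module.Basis.span_apply hs i]
  rfl

/-- The statement of `Module.Finite.exists_smul_eq_sum_smul` for a ring homomorphism. -/
theorem RingHom.Finite.exists_mul_eq_sum_mul {A B : Type*} [CommRing A] [IsDomain A] [CommRing B]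
    {F : A →+* B} (hF : F.Finite) :
    ∃ (c : A) (r : ℕ) (g : Fin r → B) (μ : Fin r → B →+ A), c ≠ 0 ∧
      (∀ i s x, μ i (F s * x) = s * μ i x) ∧ ∀ y, F c * y = ∑ i, F (μ i y) * g i := by
  let := F.toAlgebra
  have : Module.Finite A B := hF
  obtain ⟨c, r, g, μ, hc, h⟩ := Module.Finite.exists_smul_eq_sum_smul A B
  exact ⟨c, r, g, fun i => (μ i).toAddMonoidHom, hc, fun i s x => (μ i).map_smul s x, h⟩

/-- Cayley–Hamilton for multiplication by `d` on `I`: it is a root of a monic polynomial whose lower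
coefficients lie in `I`. -/
theorem exists_pow_mem_of_mul_mem_mul_self {B : Type*} [CommRing B] [IsDomain B] {I : Ideal B}
    (hfg : I.FG) (hI : I ≠ ⊥) {d : B} (h : ∀ y ∈ I, d * y ∈ I * I) : ∃ m, d ^ m ∈ I := by
  have : Module.Finite B I := Module.Finite.iff_fg.mpr hfg
  have hrange : LinearMap.range (LinearMap.lsmul B I d) ≤ I • (⊤ : Submodule B I) := by
    rintro _ ⟨⟨y, hy⟩, rfl⟩
    rw [Submodule.mem_smul_top_iff]
    exact h y hy
  obtain ⟨P, hP, -, hcoeff, hP0⟩ :=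
    LinearMap.exists_monic_and_natDegree_eq_and_coeff_mem_pow_and_aeval_eq_zero B
      (LinearMap.lsmul B I d) I hrange
  obtain ⟨y, hy, hy0⟩ := Submodule.exists_mem_ne_zero_of_ne_bot hI
  have heval : P.eval d = 0 := by
    have h1 := LinearMap.congr_fun hP0 ⟨y, hy⟩
    have h2 : Polynomial.aeval (LinearMap.lsmul B I d) P = LinearMap.lsmul B I (P.eval d) := by
      change Polynomial.aeval (algebraMap B (Module.End B I) d) P = algebraMap B _ (P.eval d)
      rw [Polynomial.aeval_algebraMap_apply, Polynomial.coe_aeval_eq_eval]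
    rw [h2] at h1
    have h3 : P.eval d * y = 0 := congrArg Subtype.val h1
    exact (mul_eq_zero.mp h3).resolve_right hy0
  refine ⟨P.natDegree, ?_⟩
  rw [Polynomial.eval_eq_sum_range, Finset.sum_range_succ, hP.coeff_natDegree, one_mul] at heval
  rw [eq_neg_of_add_eq_zero_right heval]
  refine I.neg_mem (I.sum_mem fun i hi => I.mul_mem_right _ ?_)
  exact Ideal.pow_le_self (Nat.sub_ne_zero_of_lt (Finset.mem_range.mp hi)) (hcoeff i)

/-! ### Test elements -/

/-- If `ψ` is `p^{-1}`-linear, `ψ(1) ∣ c` and `ψ(c I) ⊆ I`, then `c ^ M ∈ I` implies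
`c ^ (q + 1) ∈ I` whenever `M + 1 ≤ p q`.  Iterating, the exponent drops to at most `4`,
independently of `I`. -/
theorem pow_four_mem_of_pow_mem {p : ℕ} (hp : 2 ≤ p) {R : Type*} [CommRing R] {I : Ideal R}
    {ψ : AddMonoid.End R} (hψ : ψ ∈ cartierMaps p 1 R) {c : R} (hc : ψ 1 ∣ c)
    (hI : ∀ y ∈ I, ψ (c * y) ∈ I) {M : ℕ} (hM : c ^ M ∈ I) : c ^ 4 ∈ I := by
  induction M using Nat.strong_induction_on with
  | _ M ih =>
    by_cases hM4 : M ≤ 4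
    · exact I.pow_mem_of_pow_mem hM hM4
    -- the least `q` with `M + 1 ≤ p * q`
    set q := (M + p) / p with hq
    have hpq : M + 1 ≤ p * q := by
      have h1 := Nat.div_add_mod (M + p) p
      have h2 := Nat.mod_lt (M + p) (by omega : p > 0)
      rw [← hq] at h1
      omega
    have hqM : q + 1 < M := by
      have h1 : q = M / p + 1 := by rw [hq, Nat.add_div_right _ (by omega)]
      have h2 : M / p ≤ M / 2 := Nat.div_le_div_left hp (by omega)
      omega
    refine ih _ hqM ?_
    have hmem := hI _ (I.pow_mem_of_pow_mem hM (Nat.le_sub_one_of_lt hpq))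
    have hpow : c * c ^ (p * q - 1) = (c ^ q) ^ p ^ 1 * 1 := by
      rw [mul_pow_sub_one (by omega), pow_one, mul_one, ← pow_mul, mul_comm p q]
    rw [hpow, hψ] at hmem
    obtain ⟨w, hw⟩ := hc
    rw [pow_succ]
    nth_rewrite 2 [hw]
    rw [← mul_assoc]
    exact I.mul_mem_right w hmem

/-- In a reduced Noetherian ring a minimal prime `η` is the annihilator of some `f`, and `f ∉ η`
because otherwise `f ^ 2 = 0`. -/
theorem exists_notMem_mul_eq_zero_of_mem_minimalPrimes {R : Type*} [CommRing R] [IsNoetherianRing R]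
    [IsReduced R] {η : Ideal R} (hη : η ∈ minimalPrimes R) :
    ∃ f ∉ η, ∀ x ∈ η, f * x = 0 := by
  have hass : η ∈ associatedPrimes R R := by
    apply Module.associatedPrimes.minimalPrimes_annihilator_subset_associatedPrimes R R
    rwa [Module.annihilator_eq_bot.mpr inferInstance]
  obtain ⟨hprime, f, hf⟩ := Submodule.isAssociatedPrime_iff.mp hass
  have hmem : ∀ x, x ∈ η ↔ x * f = 0 := fun x => by
    rw [hf, Submodule.mem_colon_singleton, smul_eq_mul, Submodule.mem_bot]
  refine ⟨f, fun hfη => hprime.ne_top ?_, fun x hx => by rw [mul_comm, (hmem x).mp hx]⟩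
  rw [Ideal.eq_top_iff_one, hmem, one_mul]
  exact IsReduced.eq_zero f ⟨2, (sq f).trans ((hmem f).mp hfη)⟩

/-- On a domain `B` with finite Frobenius there are `p^{-1}`-linear maps `μ_i` that are, up to the
nonzero element `c`, the coordinates of `B` with respect to a basis over `B^p`. -/
theorem exists_cartierMaps_pow_mul_eq_sum {p : ℕ} [Fact p.Prime] {B : Type*} [CommRing B]
    [IsDomain B] [CharP B p] (hB : (frobenius B p).Finite) :
    ∃ (c : B) (r : ℕ) (g : Fin r → B) (μ : Fin r → AddMonoid.End B), c ≠ 0 ∧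
      (∀ i, μ i ∈ cartierMaps p 1 B) ∧ ∀ y, c ^ p * y = ∑ i, μ i y ^ p * g i := by
  obtain ⟨c, r, g, μ, hc, hμ, h⟩ := hB.exists_mul_eq_sum_mul
  refine ⟨c, r, g, μ, hc, fun i s x => ?_, h⟩
  rw [pow_one]
  exact hμ i s x

/-- Existence of test elements at a minimal prime `η`: some `c ∉ η` lies in every ideal `I ⊄ η`
that is closed under the maps `φ(x * -)` with `φ ∈ C_{1,R}` and `x ∈ J`. -/
theorem exists_notMem_forall_mem {p : ℕ} [Fact p.Prime] {R : Type*} [CommRing R]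
    [IsNoetherianRing R] [IsReduced R] {η : Ideal R} (hη : η ∈ minimalPrimes R)
    [CharP (R ⧸ η) p] (hF : (frobenius (R ⧸ η) p).Finite) {J : Ideal R} (hJ : ¬ J ≤ η) :
    ∃ c ∉ η, ∀ I : Ideal R, ¬ I ≤ η →
      (∀ φ ∈ cartierMaps p 1 R, ∀ x ∈ J, ∀ y ∈ I, φ (x * y) ∈ I) → c ∈ I := by
  have hp : p.Prime := Fact.out
  have hprime : η.IsPrime := hη.1.1
  obtain ⟨f, hf, hfη⟩ := exists_notMem_mul_eq_zero_of_mem_minimalPrimes hη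
  obtain ⟨b, hbJ, hb⟩ := SetLike.not_le_iff_exists.mp hJ
  obtain ⟨c', r, g, μ, hc', hμ, hsum⟩ := exists_cartierMaps_pow_mul_eq_sum hF
  obtain ⟨c, rfl⟩ := Ideal.Quotient.mk_surjective c'
  rw [Ne, Ideal.Quotient.eq_zero_iff_mem] at hc'
  -- multiplication by `f` descends to an `R`-linear map `R ⧸ η → R`
  let h : (R ⧸ η) →ₗ[R] R := Submodule.liftQ η (LinearMap.lsmul R R f) hfη
  have hmk : ∀ u, Ideal.Quotient.mk η (h u) = Ideal.Quotient.mk η f * u := by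
    intro u
    obtain ⟨u, rfl⟩ := Ideal.Quotient.mk_surjective u
    exact map_mul _ f u
  let φ : Fin r → AddMonoid.End R := fun i =>
    (h.toAddMonoidHom.comp (μ i)).comp (Ideal.Quotient.mk η).toAddMonoidHom
  have hφmk : ∀ i x, Ideal.Quotient.mk η (φ i x) =
      Ideal.Quotient.mk η f * μ i (Ideal.Quotient.mk η x) := fun i x => hmk _
  have hφ : ∀ i, φ i ∈ cartierMaps p 1 R := by
    intro i s x
    change h (μ i (Ideal.Quotient.mk η (s ^ p ^ 1 * x))) = s * h (μ i (Ideal.Quotient.mk η x))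
    rw [map_mul, map_pow, hμ i, ← smul_eq_mul s, ← map_smul, Algebra.smul_def]
    rfl
  obtain ⟨i₀, hi₀⟩ : ∃ i, φ i 1 ∉ η := by
    by_contra! hall
    have hzero : ∀ i, μ i 1 = 0 := by
      intro i
      have := (hφmk i 1).symm.trans (Ideal.Quotient.eq_zero_iff_mem.mpr (hall i))
      rw [map_one] at this
      exact (mul_eq_zero.mp this).resolve_left
        fun h => hf (Ideal.Quotient.eq_zero_iff_mem.mp h)
    have h1 := hsum 1
    rw [Finset.sum_eq_zero fun i _ => by rw [hzero, zero_pow hp.ne_zero, zero_mul], mul_one,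
      ← map_pow, Ideal.Quotient.eq_zero_iff_mem] at h1
    exact hc' (hprime.mem_of_pow_mem _ h1)
  set d := (f * b * c) ^ p with hd
  have hdη : d ∉ η := fun h => by
    rcases hprime.mem_or_mem (hprime.mem_of_pow_mem _ h) with h | h
    · exact (hprime.mem_or_mem h).elim hf hb
    · exact hc' h
  have hfd : f ∣ d := (Dvd.intro _ (mul_assoc f b c).symm).trans (dvd_pow_self _ hp.ne_zero)
  refine ⟨(φ i₀ 1 * (b * d)) ^ 4, fun h => ?_, fun I hIη hI => ?_⟩
  · rcases hprime.mem_or_mem (hprime.mem_of_pow_mem _ h) with h | h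
    · exact hi₀ h
    · exact (hprime.mem_or_mem h).elim hb hdη
  -- only `φ i (b * -)` is known to preserve `I`; apply it to `b ^ (p - 1) * y`
  have hbφ : ∀ i, ∀ y ∈ I, b * φ i y ∈ I := by
    intro i y hy
    have := hI _ (hφ i) b hbJ _ (I.mul_mem_left (b ^ (p - 1)) hy)
    rw [← mul_assoc, mul_pow_sub_one hp.ne_zero] at this
    have hb := hφ i b y
    rw [pow_one] at hb
    rwa [hb] at this
  set I' := I.map (Ideal.Quotient.mk η)
  have hI' : I' ≠ ⊥ := by
    rw [Ne, Ideal.map_eq_bot_iff_le_ker, Ideal.mk_ker]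
    exact hIη
  -- `d y` is a combination of `p`-th powers of elements of `I'`, and `p ≥ 2`
  have hsq : ∀ y ∈ I', Ideal.Quotient.mk η d * y ∈ I' * I' := by
    intro y hy
    obtain ⟨y, hyI, rfl⟩ := (Ideal.mem_map_iff_of_surjective _ Ideal.Quotient.mk_surjective).mp hy
    have hexp : Ideal.Quotient.mk η d * Ideal.Quotient.mk η y =
        ∑ i, Ideal.Quotient.mk η (b * φ i y) ^ p * g i := by
      rw [hd, map_pow, map_mul, mul_pow, mul_assoc, hsum, Finset.mul_sum]
      refine Finset.sum_congr rfl fun i _ => ?_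
      rw [map_mul _ b, hφmk, map_mul]
      ring
    rw [hexp]
    refine Ideal.sum_mem _ fun i _ => Ideal.mul_mem_right _ _ ?_
    rw [← sq]
    exact Ideal.pow_le_pow_right hp.two_le
      (Ideal.pow_mem_pow (Ideal.mem_map_of_mem _ (hbφ i y hyI)) p)
  obtain ⟨m, hm⟩ := exists_pow_mem_of_mul_mem_mul_self (IsNoetherian.noetherian I') hI' hsq
  rw [← map_pow] at hm
  obtain ⟨i, hiI, hi⟩ := (Ideal.mem_map_iff_of_surjective _ Ideal.Quotient.mk_surjective).mp hm
  -- `f` kills the difference in `η` between `d ^ m` and an element of `I`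
  have hfdm : f * d ^ m ∈ I := by
    have := hfη _ (Ideal.Quotient.eq.mp hi)
    rw [mul_sub, sub_eq_zero] at this
    exact this ▸ I.mul_mem_left f hiI
  have hdm : d ^ (m + 1) ∈ I := by
    rw [pow_succ']
    exact I.mem_of_dvd (mul_dvd_mul_right hfd _) hfdm
  refine pow_four_mem_of_pow_mem hp.two_le (hφ i₀) (Dvd.intro _ rfl) (fun y hy => ?_)
    (M := m + 1) ?_
  · have := hI _ (hφ i₀) b hbJ _ (I.mul_mem_left (φ i₀ 1 * d) hy)
    convert this using 2
    ring
  · exact I.mem_of_dvd (pow_dvd_pow_of_dvd ((dvd_mul_left d b).mul_left _) _) hdm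

namespace CartierSubalgebra

/-! ### Subadditivity -/

/-- The test ideal of `C_R^{𝔞^t}` satisfies the nontriviality condition of its own definition. -/
theorem not_testIdealPow_fullCartierAlgebra_le {p : ℕ} [Fact p.Prime] {k : Type*} [Field k]
    [CharP k p] (hk : (frobenius k p).Finite) {R : Type*} [CommRing R] [Algebra k R]
    [Algebra.EssFiniteType k R] [IsReduced R] {a : Ideal R} (t : ℝ) {η : Ideal R}
    (hη : η ∈ minimalPrimes R) (ha : ¬ a ≤ η)
    (hC : ((fullCartierAlgebra p R).twist a t).NondegenerateAt η) :
    ¬ (fullCartierAlgebra p R).testIdealPow a t ≤ η := by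
  have : η.IsPrime := hη.1.1
  have : IsNoetherianRing R := Algebra.EssFiniteType.isNoetherianRing k R
  have : CharP (R ⧸ η) p := charP_of_injective_algebraMap (algebraMap k (R ⧸ η)).injective p
  obtain ⟨c, hc, h⟩ := exists_notMem_forall_mem hη (frobenius_finite_of_essFiniteType p hk)
    (J := a ^ ⌈t * ((p : ℝ) ^ 1 - 1)⌉₊) fun h => ha (Ideal.IsPrime.le_of_pow_le h)
  refine fun hle => hc (hle (Submodule.mem_sInf.mpr fun I hI => h I (hI.2 η hη hC) ?_))
  exact fun φ hφ x hx y hy => hI.1 1 _ (mul_mulLeft_mem_twist _ hφ hx) y hy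

variable {p : ℕ} {k R : Type*} [Field k] [CommRing R] [Algebra k R]

open scoped Pointwise in
/-- The power `τ(R, C_R; 𝔞^t)^n` is compatible with `D^(n)` twisted by `(𝔞^n)^t`. -/
theorem isCompatible_testIdealPow_pow (a : Ideal R) (t : ℝ) (n : ℕ) [NeZero n] :
    ((diagonalCartierAlgebra p k R n).twist (a ^ n) t).IsCompatible
      ((fullCartierAlgebra p R).testIdealPow a t ^ n) := by
  set D := diagonalCartierAlgebra p k R n
  set T := (fullCartierAlgebra p R).testIdealPow a t
  intro e θ hθ y hy
  refine apply_mem_of_mem_twist hθ fun φ hφ x hx => ?_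
  set J := a ^ ⌈t * ((p : ℝ) ^ e - 1)⌉₊ * T with hJ
  -- `φ` is evaluated on `(𝔞^N)^n T^n = (𝔞^N T)^n`, which is spanned by products of `n` elements
  -- of `𝔞^N T`
  have hxy : x * y ∈ J ^ n := by
    rw [hJ, mul_pow, pow_right_comm]
    exact Ideal.mul_mem_mul hx hy
  have hz : ∀ z ∈ J, ∀ θ ∈ cartierMaps p e R, θ z ∈ T := by
    intro z hz θ hθ
    induction hz using Submodule.mul_induction_on' with
    | mem_mul_mem u hu v hv =>
      exact isCompatible_testIdeal _ e _
        ((fullCartierAlgebra p R).mul_mulLeft_mem_twist hθ hu) v hv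
    | add _ _ _ _ h1 h2 => rw [map_add]; exact T.add_mem h1 h2
  rw [Submodule.pow_eq_span_pow_set] at hxy
  suffices H : ∀ w ∈ Submodule.span R ((J : Set R) ^ n), ∀ φ ∈ D.deg e, φ w ∈ T ^ n from
    H _ hxy φ hφ
  intro w hw
  induction hw using Submodule.span_induction with
  | zero =>
    intro φ _
    rw [map_zero]
    exact Ideal.zero_mem _
  | add _ _ _ _ h1 h2 =>
    intro φ hφ
    rw [map_add]
    exact Ideal.add_mem _ (h1 φ hφ) (h2 φ hφ)
  | smul r _ _ h => exact fun φ hφ => h _ (D.mul_mulLeft_mem hφ r)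
  | mem w hw =>
    obtain ⟨z, rfl⟩ := Set.mem_pow.mp hw
    rw [List.prod_ofFn]
    exact fun φ hφ => diagonalCartierAlgebra_apply_prod_mem_pow hφ fun i => hz _ (z i).2

end CartierSubalgebra

theorem proposition3p4 (p : ℕ) [Fact p.Prime] (k : Type*) [Field k] [CharP k p]
    (hk : (frobenius k p).Finite)
    (R : Type*) [CommRing R] [Algebra k R] [Algebra.EssFiniteType k R] [IsReduced R]
    (a : Ideal R) (ha : ∃ x ∈ a, x ∈ nonZeroDivisors R)
    (t : ℝ) (ht : 0 ≤ t) (n m : ℕ) [NeZero n] :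
    -- (a) unambiguity
    (diagonalCartierAlgebra p k R n).testIdealPow a (m * t) =
        (diagonalCartierAlgebra p k R n).testIdealPow (a ^ m) t ∧
    -- (b) fundamental lower bound
    a * (diagonalCartierAlgebra p k R n).testIdeal ≤
        (diagonalCartierAlgebra p k R n).testIdealPow a 1 ∧
    (IsDiagonallyFRegular p k R →
      a ≤ (diagonalCartierAlgebra p k R n).testIdealPow a 1) ∧
    -- (c) subadditivity
    (diagonalCartierAlgebra p k R n).testIdealPow a (t * n) ≤
        (fullCartierAlgebra p R).testIdealPow a t ^ n := by
  have hp : p.Prime := Fact.out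
  have haη : ∀ η ∈ minimalPrimes R, ¬ a ≤ η := by
    obtain ⟨x, hxa, hx⟩ := ha
    exact fun η hη hle => notMem_nonZeroDivisors_of_mem_mem_minimalPrimes (hle hxa) hη hx
  have hb := CartierSubalgebra.mul_testIdeal_le hp (diagonalCartierAlgebra p k R n) haη
  refine ⟨CartierSubalgebra.testIdealPow_mul_eq hp _ haη ht m, hb, fun hreg => ?_, ?_⟩
  · rwa [hreg n, Ideal.mul_top] at hb
  · rw [mul_comm, CartierSubalgebra.testIdealPow_mul_eq hp _ haη ht n]
    refine sInf_le ⟨CartierSubalgebra.isCompatible_testIdealPow_pow a t n, fun η hη hC hle => ?_⟩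
    have : η.IsPrime := hη.1.1
    rw [CartierSubalgebra.nondegenerateAt_twist_iff hp _ _
      fun h => haη η hη (Ideal.IsPrime.le_of_pow_le h)] at hC
    have hfull : (fullCartierAlgebra p R).NondegenerateAt η :=
      hC.mono (diagonalCartierAlgebra p k R n).deg_le
    rw [← CartierSubalgebra.nondegenerateAt_twist_iff hp _ t (haη η hη)] at hfull
    exact CartierSubalgebra.not_testIdealPow_fullCartierAlgebra_le hk t hη (haη η hη) hfull
      (Ideal.IsPrime.le_of_pow_le hle)
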